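/- Let $L\subset\mathbb R^2$ be a lattice and let $\mathcal D$ be a hyperbolic automorphism of the torus $\mathbb R^2/L$. Coordinates are chosen so that the stable direction is horizontal and the unstable direction is vertical; thus $\mathcal D$ is induced by $D=\operatorname{diag}(\mu,\lambda)$ with $|\mu|<1<|\lambda|$ and $D(L)=L$. Given $u,v,p,q>0$ such that $[v,p]$ and $[-u,q]$ generate $L$ over $\mathbb Z$, and a point $t\in\mathbb R^2$, the rectangles $$R_1=t+[0,u]\times[0,p],\qquad R_2=t+[-v,0]\times[0,q]$$ form a bi-partition $\{R_1,R_2\}$ of $\mathbb R^2/L$. Let $J^s$ and $J^u$ be the images in the torus of the union of the horizontal sides, respectively of the vertical sides, of $R_1$ and $R_2$. The bi-partition is a Berg partition of $\mathcal D$ (that is, a Markov partition into two rectangles) if $\mathcal D(J^s)\subset J^s$ and $\mathcal D(J^u)\supset J^u$. For an ordering of the two rectangles, the connectivity matrix $C=(c_{ij})$ is the $2\times2$ matrix in which $c_{ij}$ is the number of translates $R_j+g$, $g\in L$, whose interior meets the interior of $D(R_i)$. **Theorem.** 1. Let $\{R_1,R_2\}$ be a Berg partition of $\mathcal D$ as above,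 with connectivity matrix $C$. Then $e_0=[v,p]$, $f_0=[-u,q]$ is a basis of $L$ in which $\mathcal D$ is represented by the matrix $\pm C^T$, where the sign is the sign of $\operatorname{tr}D$ (it is plus if $\lambda>1$ and minus if $\lambda<-1$). 2. (Adler–Manning) Let $C$ be a $2\times 2$ matrix with nonnegative integer entries such that $\mathcal D$ is represented in some basis of $L$ by $C^T$ or by $-C^T$. Then $\mathcal D$ has a Berg partition whose connectivity matrix, for a suitable ordering of its two rectangles, is $C$. -/

import Mathlib

noncomputable section

/-- A hyperbolic automorphism of the torus `ℝ²/L`, in coordinates whose horizontal axis is the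
stable direction (eigenvalue `mu`) and whose vertical axis is the unstable direction
(eigenvalue `lam`). -/
structure HyperbolicToralAut (L : Submodule ℤ (ℝ × ℝ)) where
  mu : ℝ
  lam : ℝ
  abs_mu_lt_one : |mu| < 1
  one_lt_abs_lam : 1 < |lam|
  map_lattice : L.map
    (((mu • LinearMap.id : ℝ →ₗ[ℝ] ℝ).prodMap (lam • LinearMap.id)).restrictScalars ℤ) = L

namespace HyperbolicToralAut

variable {L : Submodule ℤ (ℝ × ℝ)}

/-- The linear map `(x, y) ↦ (mu x, lam y)` of the plane. -/
def lift (T : HyperbolicToralAut L) : (ℝ × ℝ) →ₗ[ℝ] (ℝ × ℝ) :=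
  (T.mu • LinearMap.id : ℝ →ₗ[ℝ] ℝ).prodMap (T.lam • LinearMap.id)

theorem lift_mem (T : HyperbolicToralAut L) :
    ∀ x ∈ L, (T.lift.restrictScalars ℤ) x ∈ L := fun x hx => by
  have h : (T.lift.restrictScalars ℤ) x ∈ L.map (T.lift.restrictScalars ℤ) :=
    Submodule.mem_map_of_mem hx
  have e : L.map (T.lift.restrictScalars ℤ) = L := T.map_lattice
  rwa [e] at h

/-- The automorphism of the lattice of deck translations. -/
def onLattice (T : HyperbolicToralAut L) : L →ₗ[ℤ] L :=
  (T.lift.restrictScalars ℤ).restrict T.lift_mem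

/-- The induced map of the torus `ℝ²/L`. -/
def toralMap (T : HyperbolicToralAut L) : ((ℝ × ℝ) ⧸ L) →ₗ[ℤ] ((ℝ × ℝ) ⧸ L) :=
  L.mapQ L (T.lift.restrictScalars ℤ) T.lift_mem

/-- The connectivity matrix of two rectangles `R 0`, `R 1` in the plane: the `(i, j)` entry is the
number of lattice translates of `R j` that the image of `R i` overlaps (meets in more than boundary
points). -/
def connectivityMatrix (T : HyperbolicToralAut L) (R : Fin 2 → Set (ℝ × ℝ)) :
    Matrix (Fin 2) (Fin 2) ℕ :=
  fun i j => Set.ncard {g : L |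
    (interior (T.lift '' R i) ∩ interior ((fun x => (g : ℝ × ℝ) + x) '' R j)).Nonempty}

end HyperbolicToralAut

/-- A bi-partition of `ℝ²/L`. The first rectangle has width `u` and height `p`, the second has
width `v` and height `q`. They stand on a common horizontal line, the second one immediately to the
left of the first one, `base` being the common point of their lower sides. -/
structure BiPartition (L : Submodule ℤ (ℝ × ℝ)) where
  u : ℝ
  v : ℝ
  p : ℝ
  q : ℝ
  base : ℝ × ℝ
  u_pos : 0 < u
  v_pos : 0 < v
  p_pos : 0 < p
  q_pos : 0 < q
  lattice_eq : L = Submodule.span ℤ {((v, p) : ℝ × ℝ), ((-u, q) : ℝ × ℝ)}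

namespace BiPartition

variable {L : Submodule ℤ (ℝ × ℝ)}

/-- The left ends of the two rectangles. -/
def left (P : BiPartition L) : Fin 2 → ℝ := ![P.base.1, P.base.1 - P.v]

/-- The right ends of the two rectangles. -/
def right (P : BiPartition L) : Fin 2 → ℝ := ![P.base.1 + P.u, P.base.1]

/-- The common height of the lower sides of the two rectangles. -/
def bottom (P : BiPartition L) : ℝ := P.base.2

/-- The heights of the upper sides of the two rectangles. -/
def top (P : BiPartition L) : Fin 2 → ℝ := ![P.base.2 + P.p, P.base.2 + P.q]

/-- The two closed rectangles in the plane. -/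
def rect (P : BiPartition L) (i : Fin 2) : Set (ℝ × ℝ) :=
  Set.Icc (P.left i) (P.right i) ×ˢ Set.Icc P.bottom (P.top i)

/-- The union in the torus of the horizontal sides of the two rectangles. -/
def horizontalSpine (P : BiPartition L) : Set ((ℝ × ℝ) ⧸ L) :=
  L.mkQ '' ⋃ i, Set.Icc (P.left i) (P.right i) ×ˢ {P.bottom, P.top i}

/-- The union in the torus of the vertical sides of the two rectangles. -/
def verticalSpine (P : BiPartition L) : Set ((ℝ × ℝ) ⧸ L) :=
  L.mkQ '' ⋃ i, {P.left i, P.right i} ×ˢ Set.Icc P.bottom (P.top i)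

/-- A bi-partition is a Berg partition if the horizontal spine is mapped into itself and the
vertical spine is covered by its image. -/
def IsBerg (P : BiPartition L) (T : HyperbolicToralAut L) : Prop :=
  T.toralMap '' P.horizontalSpine ⊆ P.horizontalSpine ∧
    P.verticalSpine ⊆ T.toralMap '' P.verticalSpine

end BiPartition

end

/-!
Part 1. The translates of `R₁ ∪ R₂` met by a vertical line are stacked on each other, so they cut
the line into consecutive segments of lengths `p` and `q`. By the Markov property a vertical segment
across `D(R_i)` is a union of such segments, and the `(i, j)` entry of `C` counts those coming from
translates of `R_j`. Comparing lengths gives `|λ| h = C h` for the vector `h = (p, q)`, so `D e_i`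
and `sign λ • ∑ j, c_ij e_j` are lattice vectors with the same second coordinate. They coincide
because the iterates of `D` would contract a nonzero lattice vector on the stable axis to `0`.

Part 2. The first and the second coordinates of a basis in which `D` is `± C^T` are eigenvectors of
`C` for `± μ` and `± λ`. The off-diagonal entries of `C` are positive: otherwise its eigenvalues
would be its diagonal entries, whereas `± μ` is not an integer. So the Perron–Frobenius theorem
gives the signs of the coordinates, and after a permutation and a common change of sign the basis is
`[v, p]`, `[-u, q]` with `u, v, p, q > 0`. Put the common lower side of the rectangles on the stable
axis, with the base point such that the image of this side is a lattice translate of a part of it.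
Then the bi-partition is a Berg partition, and by Part 1 its connectivity matrix is `C`.
-/

section Order

theorem abs_intUnits_mul {R : Type*} [Ring R] [LinearOrder R] [IsStrictOrderedRing R]
    (s : ℤˣ) (r : R) : |(s : ℤ) * r| = |r| := by
  rw [abs_mul, ← Int.cast_abs, Int.isUnit_iff_abs_eq.1 s.isUnit, Int.cast_one, one_mul]

theorem subset_Ioo_of_ordConnected {α : Type*} [LinearOrder α] {s : Set α} (hs : s.OrdConnected)
    {c d : α} (hmeet : (s ∩ Set.Ioo c d).Nonempty) (hc : c ∉ s) (hd : d ∉ s) :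
    s ⊆ Set.Ioo c d := by
  obtain ⟨x, hxs, hcx, hxd⟩ := hmeet
  refine fun y hy => ⟨?_, ?_⟩
  · by_contra! hyc
    exact hc (hs.out hy hxs ⟨hyc, hcx.le⟩)
  · by_contra! hdy
    exact hd (hs.out hxs hy ⟨hxd.le, hdy⟩)

variable {K : Type*} [Field K] [LinearOrder K] [IsStrictOrderedRing K]

theorem exists_div_mem_Ioo_iff {r : K} (hr : r ≠ 0) {a b : K} (hab : a < b) :
    ∃ c d, c < d ∧ d - c = |r| * (b - a) ∧ ∀ t, t / r ∈ Set.Ioo a b ↔ t ∈ Set.Ioo c d := by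
  rcases hr.lt_or_gt with hr | hr
  · refine ⟨b * r, a * r, mul_lt_mul_of_neg_right hab hr, by rw [abs_of_neg hr]; ring, fun t => ?_⟩
    rw [Set.mem_Ioo, lt_div_iff_of_neg hr, div_lt_iff_of_neg hr, and_comm, Set.mem_Ioo]
  · refine ⟨a * r, b * r, mul_lt_mul_of_pos_right hab hr, by rw [abs_of_pos hr]; ring, fun t => ?_⟩
    rw [Set.mem_Ioo, lt_div_iff₀ hr, div_lt_iff₀ hr, Set.mem_Ioo]

theorem exists_mem_Ico_of_add_le [Archimedean K] {H : ℤ → K} {δ : K} (hδ : 0 < δ)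
    (hH : ∀ k, H k + δ ≤ H (k + 1)) (y : K) : ∃ k, y ∈ Set.Ico (H k) (H (k + 1)) := by
  have hmono : Monotone fun k : ℤ => H k - k * δ :=
    monotone_int_of_le_succ fun k => by push_cast; linarith [hH k]
  obtain ⟨n, hn⟩ := exists_nat_ge (|y - H 0| / δ)
  rw [div_le_iff₀ hδ, abs_le] at hn
  have hbounded : ∀ k, H k ≤ y → k ≤ n := by
    intro k hk
    by_contra! hnk
    have h0 := hmono (show 0 ≤ k by lia)
    have hnk' : (n : K) * δ < k * δ := mul_lt_mul_of_pos_right (by exact_mod_cast hnk) hδ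
    push_cast at h0
    linarith
  have hinhabited : H (-n) ≤ y := by
    have h0 := hmono (show -(n : ℤ) ≤ 0 by lia)
    push_cast at h0
    linarith
  obtain ⟨k, hk, hmax⟩ := Int.exists_greatest_of_bdd ⟨n, hbounded⟩ ⟨-n, hinhabited⟩
  exact ⟨k, hk, not_le.1 fun h => absurd (hmax _ h) (by lia)⟩

theorem sum_Ico_int_sub {M : Type*} [AddCommGroup M] (f : ℤ → M) {a b : ℤ} (hab : a ≤ b) :
    ∑ k ∈ Finset.Ico a b, (f (k + 1) - f k) = f b - f a := by
  induction b, hab using Int.leInduction with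
  | base => simp
  | succ b hab ih =>
    rw [← Finset.insert_Ico_right_eq_Ico_add_one hab, Finset.sum_insert (by simp), ih]
    abel

/- The tile that contains `c` would stick out of `(c, d)` if it did not start at `c`; likewise
for `d`. Hence the tiles meeting `(c, d)` are consecutive and fill it exactly. -/
theorem exists_finset_sum_sub_eq {H : ℤ → K} (hH : StrictMono H)
    (hcover : ∀ y, ∃ k, y ∈ Set.Ico (H k) (H (k + 1))) {c d : K} (hcd : c < d)
    (hsub : ∀ k, (Set.Ioo (H k) (H (k + 1)) ∩ Set.Ioo c d).Nonempty →
      Set.Ioo (H k) (H (k + 1)) ⊆ Set.Ioo c d) :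
    ∃ s : Finset ℤ, (∀ k, k ∈ s ↔ (Set.Ioo (H k) (H (k + 1)) ∩ Set.Ioo c d).Nonempty) ∧
      ∑ k ∈ s, (H (k + 1) - H k) = d - c := by
  have hstep : ∀ k, H k < H (k + 1) := fun k => hH (lt_add_one k)
  have hmeet : ∀ k, (Set.Ioo (H k) (H (k + 1)) ∩ Set.Ioo c d).Nonempty ↔
      H k < d ∧ c < H (k + 1) := fun k => by
    rw [Set.Ioo_inter_Ioo, Set.nonempty_Ioo, max_lt_iff, lt_min_iff, lt_min_iff]
    simp only [hstep, hcd, true_and, and_true]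
  have hinside : ∀ k, H k < d → c < H (k + 1) → c ≤ H k ∧ H (k + 1) ≤ d := fun k h₁ h₂ =>
    (Set.Ioo_subset_Ioo_iff (hstep k)).1 (hsub k ((hmeet k).2 ⟨h₁, h₂⟩))
  obtain ⟨a, hac, hca⟩ := hcover c
  obtain ⟨b, hbd, hdb⟩ := hcover d
  have ha : H a = c := hac.antisymm (hinside a (hac.trans_lt hcd) hca).1
  have hb : H b = d := by
    by_contra hne
    exact hdb.not_ge (hinside b (lt_of_le_of_ne hbd hne) (hcd.trans hdb)).2
  refine ⟨Finset.Ico a b, fun k => ?_, ?_⟩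
  · rw [hmeet, ← ha, ← hb, hH.lt_iff_lt, hH.lt_iff_lt, Finset.mem_Ico, Int.lt_add_one_iff, and_comm]
  · rw [sum_Ico_int_sub H (hH.le_iff_le.1 (by rw [ha, hb]; exact hcd.le)), ha, hb]

end Order

section Matrix

open Matrix

theorem toMatrix_eq_iff {R M ι : Type*} [CommRing R] [AddCommGroup M] [Module R M] [Fintype ι]
    [DecidableEq ι] (b : Module.Basis ι R M) (f : M →ₗ[R] M) (A : Matrix ι ι R) :
    LinearMap.toMatrix b b f = A ↔ ∀ j, f (b j) = ∑ i, A i j • b i := by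
  rw [← LinearEquiv.eq_symm_apply, LinearMap.toMatrix_symm]
  refine ⟨fun h j => by rw [h, toLin_self], fun h => b.ext fun j => ?_⟩
  rw [h, toLin_self]

theorem toMatrix_unitsSMul_reindex {R M ι : Type*} [CommRing R] [AddCommGroup M] [Module R M]
    [Fintype ι] [DecidableEq ι] (b : Module.Basis ι R M) (f : M →ₗ[R] M) (ε : Rˣ)
    (σ : Equiv.Perm ι) :
    let b' := (b.reindex σ.symm).unitsSMul fun _ => ε
    LinearMap.toMatrix b' b' f = (LinearMap.toMatrix b b f).submatrix σ σ := by
  refine (toMatrix_eq_iff _ _ _).2 fun j => ?_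
  have hb := (toMatrix_eq_iff b f _).1 rfl (σ j)
  simp only [Module.Basis.unitsSMul_apply, Module.Basis.reindex_apply, Equiv.symm_symm,
    submatrix_apply, Units.smul_def, map_smul, hb, Finset.smul_sum]
  rw [← Equiv.sum_comp σ]
  exact Finset.sum_congr rfl fun i _ => smul_comm _ _ _

theorem sub_mul_sub_eq_of_mulVec_eq_smul {K : Type*} [Field K] {A : Matrix (Fin 2) (Fin 2) K}
    {r : K} {x : Fin 2 → K} (hx : x ≠ 0) (h : A *ᵥ x = r • x) :
    (A 0 0 - r) * (A 1 1 - r) = A 0 1 * A 1 0 := by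
  have hdet : (A - r • (1 : Matrix (Fin 2) (Fin 2) K)).det = 0 :=
    exists_mulVec_eq_zero_iff.1 ⟨x, hx, by rw [sub_mulVec, h, smul_mulVec, one_mulVec, sub_self]⟩
  simpa [det_fin_two, sub_eq_zero] using hdet

theorem mul_ne_zero_of_eigenvalue_abs_lt_one {K : Type*} [Field K] [LinearOrder K]
    [IsStrictOrderedRing K] {A : Matrix (Fin 2) (Fin 2) K} (hA : ∀ i, ∃ n : ℤ, A i i = n) {r : K}
    (hr : r ≠ 0) (hr1 : |r| < 1) {x : Fin 2 → K} (hx : x ≠ 0) (h : A *ᵥ x = r • x) :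
    A 0 1 * A 1 0 ≠ 0 := by
  have hdiag : ∀ i, A i i - r ≠ 0 := by
    intro i hi
    obtain ⟨n, hn⟩ := hA i
    obtain rfl : r = n := by rw [← hn, sub_eq_zero.1 hi]
    obtain rfl : n = 0 := Int.abs_lt_one_iff.1 (by exact_mod_cast hr1)
    exact hr Int.cast_zero
  rw [← sub_mul_sub_eq_of_mulVec_eq_smul hx h]
  exact mul_ne_zero (hdiag 0) (hdiag 1)

theorem perron_frobenius_fin_two {K : Type*} [Field K] [LinearOrder K] [IsStrictOrderedRing K]
    {A : Matrix (Fin 2) (Fin 2) K} (hA : ∀ i, 0 ≤ A i i) (h01 : 0 < A 0 1) (h10 : 0 < A 1 0)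
    {r m : K} (hmr : |m| < |r|) {x y : Fin 2 → K} (hx : x ≠ 0) (hy : y ≠ 0)
    (hAx : A *ᵥ x = m • x) (hAy : A *ᵥ y = r • y) :
    x 0 * x 1 < 0 ∧ 0 < y 0 * y 1 := by
  have hm := sub_mul_sub_eq_of_mulVec_eq_smul hx hAx
  have hr := sub_mul_sub_eq_of_mulVec_eq_smul hy hAy
  have hoff : 0 < A 0 1 * A 1 0 := mul_pos h01 h10
  have hne : r - m ≠ 0 := sub_ne_zero.2 fun h => hmr.ne (congrArg abs h).symm
  have htrace : A 0 0 + A 1 1 = r + m := mul_left_cancel₀ hne (by linear_combination hm - hr)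
  have hmr' : m < r := by
    have := abs_lt.1 hmr
    rcases abs_cases r with h | h <;> linarith [hA 0, hA 1]
  have hdiag_r : A 0 0 < r := by
    by_contra! h
    nlinarith
  have hdiag_m : m < A 0 0 := by
    by_contra! h
    nlinarith
  have hrow : ∀ {s : K} {z : Fin 2 → K}, A *ᵥ z = s • z → A 0 1 * z 1 = (s - A 0 0) * z 0 := by
    intro s z hz
    have h0 := congrFun hz 0
    rw [mulVec, dotProduct, Fin.sum_univ_two, Pi.smul_apply, smul_eq_mul] at h0
    linear_combination h0
  have hsq : ∀ {s : K} {z : Fin 2 → K}, z ≠ 0 → A *ᵥ z = s • z → 0 < z 0 ^ 2 := by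
    intro s z hz hAz
    refine sq_pos_of_ne_zero fun h0 => hz (funext (Fin.forall_fin_two.2 ⟨h0, ?_⟩))
    simpa [h0, h01.ne'] using hrow hAz
  constructor
  · refine neg_of_mul_neg_right (a := A 0 1) ?_ h01.le
    calc A 0 1 * (x 0 * x 1) = (m - A 0 0) * x 0 ^ 2 := by linear_combination x 0 * hrow hAx
      _ < 0 := mul_neg_of_neg_of_pos (sub_neg.2 hdiag_m) (hsq hx hAx)
  · refine pos_of_mul_pos_right (a := A 0 1) ?_ h01.le
    calc 0 < (r - A 0 0) * y 0 ^ 2 := mul_pos (sub_pos.2 hdiag_r) (hsq hy hAy)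
      _ = A 0 1 * (y 0 * y 1) := by linear_combination -y 0 * hrow hAy

theorem exists_sign_perm {K : Type*} [Field K] [LinearOrder K] [IsStrictOrderedRing K]
    {x y : Fin 2 → K} (hx : x 0 * x 1 < 0) (hy : 0 < y 0 * y 1) :
    ∃ (ε : ℤˣ) (σ : Equiv.Perm (Fin 2)), 0 < ε • x (σ 0) ∧ ε • x (σ 1) < 0 ∧ ∀ i, 0 < ε • y i := by
  obtain ⟨ε, hε⟩ : ∃ ε : ℤˣ, ∀ i, 0 < ε • y i := by
    rcases mul_pos_iff.1 hy with h | h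
    · exact ⟨1, Fin.forall_fin_two.2 (by simpa using h)⟩
    · exact ⟨-1, Fin.forall_fin_two.2 (by simpa [Units.smul_def] using h)⟩
  have hxε : (ε • x 0) * (ε • x 1) < 0 := by
    rwa [smul_mul_smul_comm, Int.units_mul_self, one_smul]
  rcases mul_neg_iff.1 hxε with h | h
  · exact ⟨ε, Equiv.refl _, h.1, h.2, hε⟩
  · exact ⟨ε, Equiv.swap 0 1, by simpa using h.2, by simpa using h.1, hε⟩

end Matrix

section Lattice

theorem mkQ_mem_image_iff {R M : Type*} [Ring R] [AddCommGroup M] [Module R M]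
    {N : Submodule R M} {s : Set M} {z : M} : N.mkQ z ∈ N.mkQ '' s ↔ ∃ g ∈ N, z - g ∈ s := by
  constructor
  · rintro ⟨w, hw, hwz⟩
    exact ⟨z - w, (Submodule.Quotient.eq N).1 hwz.symm, by rwa [sub_sub_cancel]⟩
  · rintro ⟨g, hg, hs⟩
    exact ⟨z - g, hs, (Submodule.Quotient.eq N).2 (by simpa using hg)⟩

theorem apply_basis_ne_zero {E F ι : Type*} [NormedAddCommGroup E] [NormedSpace ℝ E]
    [FiniteDimensional ℝ E]
    [AddCommGroup F] [Module ℝ F] {L : Submodule ℤ E} [DiscreteTopology L] [IsZLattice ℝ L]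
    (b : Module.Basis ι ℤ L) {ℓ : E →ₗ[ℝ] F} (hℓ : ℓ ≠ 0) :
    (fun i => ℓ (b i)) ≠ 0 := fun h =>
  hℓ ((b.ofZLatticeBasis ℝ L).ext fun i => by
    rw [b.ofZLatticeBasis_apply ℝ L]
    exact congrFun h i)

end Lattice

namespace HyperbolicToralAut

variable {L : Submodule ℤ (ℝ × ℝ)}

theorem lift_apply (T : HyperbolicToralAut L) (z : ℝ × ℝ) :
    T.lift z = (T.mu * z.1, T.lam * z.2) := by
  simp [lift]

theorem lam_ne_zero (T : HyperbolicToralAut L) : T.lam ≠ 0 :=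
  abs_pos.1 (one_pos.trans T.one_lt_abs_lam)

theorem exists_lift_eq (T : HyperbolicToralAut L) {z : ℝ × ℝ} (hz : z ∈ L) :
    ∃ w ∈ L, T.lift w = z := by
  rwa [← T.map_lattice] at hz

theorem mu_ne_zero (T : HyperbolicToralAut L) {z : ℝ × ℝ} (hz : z ∈ L) (hz1 : z.1 ≠ 0) :
    T.mu ≠ 0 := by
  obtain ⟨w, -, rfl⟩ := T.exists_lift_eq hz
  exact fun h => hz1 (by rw [lift_apply, h, zero_mul])

theorem lift_injective (T : HyperbolicToralAut L) (hmu : T.mu ≠ 0) :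
    Function.Injective T.lift := by
  intro a b h
  simp only [lift_apply, Prod.mk.injEq] at h
  exact Prod.ext (mul_left_cancel₀ hmu h.1) (mul_left_cancel₀ T.lam_ne_zero h.2)

theorem toralMap_mkQ (T : HyperbolicToralAut L) (z : ℝ × ℝ) :
    T.toralMap (L.mkQ z) = L.mkQ (T.lift z) :=
  rfl

theorem toralMap_injective (T : HyperbolicToralAut L) (hmu : T.mu ≠ 0) :
    Function.Injective T.toralMap := by
  refine (injective_iff_map_eq_zero _).2 fun a ha => ?_
  obtain ⟨z, rfl⟩ := L.mkQ_surjective a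
  rw [toralMap_mkQ] at ha
  obtain ⟨w, hw, hwz⟩ := T.exists_lift_eq ((Submodule.Quotient.mk_eq_zero L).1 ha)
  exact (Submodule.Quotient.mk_eq_zero L).2 (T.lift_injective hmu hwz ▸ hw)

theorem interior_image_lift (T : HyperbolicToralAut L) (hmu : T.mu ≠ 0) (s : Set (ℝ × ℝ)) :
    interior (T.lift '' s) = T.lift '' interior s := by
  have hlift : ⇑T.lift = (Homeomorph.mulLeft₀ T.mu hmu).prodCongr
      (Homeomorph.mulLeft₀ T.lam T.lam_ne_zero) :=
    funext T.lift_apply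
  rw [hlift, Homeomorph.image_interior]

theorem sign_trace_lift (T : HyperbolicToralAut L) :
    SignType.sign (LinearMap.trace ℝ (ℝ × ℝ) T.lift) = SignType.sign T.lam := by
  have htrace : LinearMap.trace ℝ (ℝ × ℝ) T.lift = T.mu + T.lam := by
    simp [lift, LinearMap.trace_prodMap']
  have hmu := abs_lt.1 T.abs_mu_lt_one
  rw [htrace]
  rcases lt_abs.1 T.one_lt_abs_lam with h | h
  · rw [sign_pos (by linarith), sign_pos (by linarith)]
  · rw [sign_neg (by linarith), sign_neg (by linarith)]

theorem coe_iterate_onLattice (T : HyperbolicToralAut L) (n : ℕ) (x : L) :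
    ((T.onLattice^[n] x : L) : ℝ × ℝ) = (T.mu ^ n * (x : ℝ × ℝ).1, T.lam ^ n * (x : ℝ × ℝ).2) := by
  induction n with
  | zero => simp
  | succ n ih =>
    rw [Function.iterate_succ_apply']
    refine (congrArg T.lift ih).trans ?_
    rw [lift_apply, pow_succ', pow_succ', mul_assoc, mul_assoc]

/- The iterates of a lattice vector on the stable axis tend to `0`, hence reach it. -/
theorem eq_of_snd_eq (T : HyperbolicToralAut L) [DiscreteTopology L] {x y : L}
    (h : (x : ℝ × ℝ).2 = (y : ℝ × ℝ).2) :
    x = y := by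
  set z : L := x - y
  have hz2 : (z : ℝ × ℝ).2 = 0 := sub_eq_zero.2 h
  have hlim : Filter.Tendsto (fun n => T.onLattice^[n] z) Filter.atTop (nhds 0) := by
    rw [tendsto_subtype_rng]
    simp only [coe_iterate_onLattice, hz2, mul_zero, ZeroMemClass.coe_zero]
    have hpow := (tendsto_pow_atTop_nhds_zero_of_abs_lt_one T.abs_mu_lt_one).mul_const (z : ℝ × ℝ).1
    rw [zero_mul] at hpow
    exact hpow.prodMk_nhds tendsto_const_nhds
  rw [nhds_discrete, Filter.tendsto_pure] at hlim
  obtain ⟨n, hn⟩ := hlim.exists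
  have hn1 := congrArg (fun w : L => (w : ℝ × ℝ).1) hn
  simp only [coe_iterate_onLattice, ZeroMemClass.coe_zero, Prod.fst_zero] at hn1
  by_contra hxy
  have hz1 : (z : ℝ × ℝ).1 ≠ 0 := fun h1 =>
    hxy (sub_eq_zero.1 (Subtype.ext (Prod.ext h1 hz2)))
  exact mul_ne_zero (pow_ne_zero n (T.mu_ne_zero z.2 hz1)) hz1 hn1

end HyperbolicToralAut

namespace BiPartition

variable {L : Submodule ℤ (ℝ × ℝ)} (P : BiPartition L)

/-- The vectors `e₀ = [v, p]` and `f₀ = [-u, q]` of the paper. Numbered by `Fin 2` so that the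
rectangle `P.rect i` is as high as `P.generator i`. -/
def generator : Fin 2 → ℝ × ℝ :=
  ![(P.v, P.p), (-P.u, P.q)]

theorem linearIndependent_generator : LinearIndependent ℤ P.generator := by
  have hR : LinearIndependent ℝ P.generator := by
    refine LinearIndependent.pair_iff.2 fun s t h => ?_
    simp only [Prod.smul_mk, smul_eq_mul, Prod.mk_add_mk, Prod.mk_eq_zero] at h
    have hdet : 0 < P.v * P.q + P.u * P.p :=
      add_pos (mul_pos P.v_pos P.q_pos) (mul_pos P.u_pos P.p_pos)
    refine ⟨(mul_eq_zero.1 ?_).resolve_right hdet.ne', (mul_eq_zero.1 ?_).resolve_right hdet.ne'⟩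
    · linear_combination P.q * h.1 + P.u * h.2
    · linear_combination P.v * h.2 - P.p * h.1
  exact hR.restrict_scalars' ℤ

theorem span_range_generator : Submodule.span ℤ (Set.range P.generator) = L := by
  conv_rhs => rw [P.lattice_eq]
  rw [generator, Matrix.range_cons_cons_empty]

/-- The basis `e₀ = [v, p]`, `f₀ = [-u, q]` of the lattice. -/
noncomputable def basis : Module.Basis (Fin 2) ℤ L :=
  (Module.Basis.span P.linearIndependent_generator).map
    (LinearEquiv.ofEq _ _ P.span_range_generator)

theorem coe_basis (i : Fin 2) : (P.basis i : ℝ × ℝ) = P.generator i := by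
  simp [basis, Module.Basis.span_apply]

theorem mu_ne_zero (P : BiPartition L) (T : HyperbolicToralAut L) : T.mu ≠ 0 :=
  T.mu_ne_zero (P.basis 0).2 (by rw [coe_basis]; exact P.v_pos.ne')

theorem generator_snd_pos (i : Fin 2) : 0 < (P.generator i).2 := by
  fin_cases i
  exacts [P.p_pos, P.q_pos]

theorem min_le_generator_snd (i : Fin 2) : min P.p P.q ≤ (P.generator i).2 := by
  fin_cases i
  exacts [min_le_left _ _, min_le_right _ _]

theorem generator_snd_le_max (i : Fin 2) : (P.generator i).2 ≤ max P.p P.q := by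
  fin_cases i
  exacts [le_max_left _ _, le_max_right _ _]

theorem top_eq (i : Fin 2) : P.top i = P.bottom + (P.generator i).2 := by
  fin_cases i <;> rfl

theorem bottom_lt_top (i : Fin 2) : P.bottom < P.top i := by
  rw [top_eq]
  exact lt_add_of_pos_right _ (P.generator_snd_pos i)

theorem left_lt_right (i : Fin 2) : P.left i < P.right i := by
  fin_cases i
  exacts [lt_add_of_pos_right _ P.u_pos, sub_lt_self _ P.v_pos]

/-- The interiors of the two rectangles. -/
def openRect (i : Fin 2) : Set (ℝ × ℝ) :=
  Set.Ioo (P.left i) (P.right i) ×ˢ Set.Ioo P.bottom (P.top i)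

theorem interior_rect (i : Fin 2) : interior (P.rect i) = P.openRect i := by
  rw [rect, openRect, interior_prod_eq, interior_Icc, interior_Icc]

theorem closure_openRect (i : Fin 2) : closure (P.openRect i) = P.rect i := by
  rw [openRect, closure_prod_eq, closure_Ioo (P.left_lt_right i).ne,
    closure_Ioo (P.bottom_lt_top i).ne, rect]

theorem isOpen_openRect (i : Fin 2) : IsOpen (P.openRect i) :=
  isOpen_Ioo.prod isOpen_Ioo

/-- The lattice vectors `g` such that the vertical line at abscissa `x` meets the base of
`(R₁ ∪ R₂) + g`, its right end excluded, listed by increasing height. If `g = m e₀ + n f₀` is such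
a vector, then its index is `m + n`. -/
noncomputable def column (x : ℝ) (k : ℤ) : L :=
  let m := toIcoDiv (add_pos P.u_pos P.v_pos) (P.base.1 - P.v) (x + k * P.u)
  m • P.basis 0 + (k - m) • P.basis 1

/-- The rectangle whose translate by `P.column x k` the vertical line at abscissa `x` crosses. -/
noncomputable def columnRect (x : ℝ) (k : ℤ) : Fin 2 :=
  if P.base.1 ≤ x - (P.column x k : ℝ × ℝ).1 then 0 else 1

theorem coe_zsmul_basis_add (m n : ℤ) : ((m • P.basis 0 + n • P.basis 1 : L) : ℝ × ℝ) =
    (m * P.v - n * P.u, m * P.p + n * P.q) := by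
  simp [coe_basis, generator, sub_eq_add_neg]

theorem column_eq_iff {x : ℝ} {k : ℤ} {g : L} : P.column x k = g ↔
    ∃ m, g = m • P.basis 0 + (k - m) • P.basis 1 ∧
      x - (g : ℝ × ℝ).1 ∈ Set.Ico (P.base.1 - P.v) (P.base.1 + P.u) := by
  have hmem : ∀ m : ℤ, toIcoDiv (add_pos P.u_pos P.v_pos) (P.base.1 - P.v) (x + k * P.u) = m ↔
      x - ((m • P.basis 0 + (k - m) • P.basis 1 : L) : ℝ × ℝ).1 ∈
        Set.Ico (P.base.1 - P.v) (P.base.1 + P.u) := fun m => by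
    rw [toIcoDiv_eq_iff, coe_zsmul_basis_add]
    have h₁ : x + k * P.u - m • (P.u + P.v) = x - (m * P.v - (k - m : ℤ) * P.u) := by
      push_cast [zsmul_eq_mul]; ring
    rw [h₁, show P.base.1 - P.v + (P.u + P.v) = P.base.1 + P.u by ring]
  constructor
  · rintro rfl
    exact ⟨_, rfl, (hmem _).1 rfl⟩
  · rintro ⟨m, rfl, hm⟩
    rw [column, (hmem m).2 hm]

theorem sub_column_mem_Ico (x : ℝ) (k : ℤ) : x - (P.column x k : ℝ × ℝ).1 ∈
    Set.Ico (P.left (P.columnRect x k)) (P.right (P.columnRect x k)) := by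
  obtain ⟨m, -, h⟩ := P.column_eq_iff.1 (rfl : P.column x k = _)
  rw [columnRect]
  split_ifs with hx
  exacts [⟨hx, h.2⟩, ⟨h.1, not_le.1 hx⟩]

theorem column_add_one (x : ℝ) (k : ℤ) :
    P.column x (k + 1) = P.column x k + P.basis (P.columnRect x k) := by
  obtain ⟨m, hm, -⟩ := P.column_eq_iff.1 (rfl : P.column x k = _)
  have hk := P.sub_column_mem_Ico x k
  refine P.column_eq_iff.2 ?_
  have hu := P.u_pos
  have hv := P.v_pos
  rw [Submodule.coe_add, coe_basis, Prod.fst_add, Set.mem_Ico]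
  match P.columnRect x k, hk with
  | 0, hk =>
    simp only [generator, left, right, Matrix.cons_val, Set.mem_Ico] at hk ⊢
    refine ⟨m + 1, ?_, by linarith, by linarith⟩
    rw [hm]
    module
  | 1, hk =>
    simp only [generator, left, right, Matrix.cons_val, Set.mem_Ico] at hk ⊢
    refine ⟨m, ?_, by linarith, by linarith⟩
    rw [hm]
    module

theorem exists_column_eq {x : ℝ} {g : L} {j : Fin 2}
    (h : x - (g : ℝ × ℝ).1 ∈ Set.Ico (P.left j) (P.right j)) :
    ∃ k, P.column x k = g ∧ P.columnRect x k = j := by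
  have hu := P.u_pos
  have hv := P.v_pos
  obtain ⟨m, n, hg⟩ : ∃ m n : ℤ, g = m • P.basis 0 + n • P.basis 1 :=
    ⟨P.basis.repr g 0, P.basis.repr g 1, by
      rw [← Fin.sum_univ_two (fun i => P.basis.repr g i • P.basis i), P.basis.sum_repr]⟩
  have hcol : P.column x (m + n) = g := by
    refine P.column_eq_iff.2 ⟨m, by rwa [add_sub_cancel_left], Set.Ico_subset_Ico ?_ ?_ h⟩
    · fin_cases j
      exacts [sub_le_self _ hv.le, le_rfl]
    · fin_cases j
      exacts [le_rfl, le_add_of_nonneg_right hu.le]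
  refine ⟨m + n, hcol, ?_⟩
  rw [columnRect, hcol]
  fin_cases j
  exacts [if_pos h.1, if_neg (not_le.2 h.2)]

/-- The height of the base of the translate of `R₁ ∪ R₂` by `P.column x k`. -/
noncomputable def columnHeight (x : ℝ) (k : ℤ) : ℝ :=
  P.bottom + (P.column x k : ℝ × ℝ).2

theorem columnHeight_add_one (x : ℝ) (k : ℤ) :
    P.columnHeight x (k + 1) = P.columnHeight x k + (P.generator (P.columnRect x k)).2 := by
  rw [columnHeight, column_add_one, Submodule.coe_add, coe_basis, Prod.snd_add, ← add_assoc,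
    columnHeight]

theorem columnHeight_strictMono (x : ℝ) : StrictMono (P.columnHeight x) :=
  strictMono_int_of_lt_succ fun k => by
    rw [columnHeight_add_one]
    exact lt_add_of_pos_right _ (P.generator_snd_pos _)

theorem exists_mem_Ico_columnHeight (x y : ℝ) :
    ∃ k, y ∈ Set.Ico (P.columnHeight x k) (P.columnHeight x (k + 1)) := by
  refine exists_mem_Ico_of_add_le (lt_min P.p_pos P.q_pos) (fun k => ?_) y
  rw [columnHeight_add_one]
  exact add_le_add_right (P.min_le_generator_snd _) _

theorem sub_mem_Ioo_bottom_top_iff {x y : ℝ} {k : ℤ} :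
    y - (P.column x k : ℝ × ℝ).2 ∈ Set.Ioo P.bottom (P.top (P.columnRect x k)) ↔
      y ∈ Set.Ioo (P.columnHeight x k) (P.columnHeight x (k + 1)) := by
  rw [columnHeight_add_one, columnHeight, top_eq, Set.mem_Ioo, Set.mem_Ioo, lt_sub_iff_add_lt,
    sub_lt_iff_lt_add, add_right_comm]

theorem column_injective (x : ℝ) : Function.Injective (P.column x) := fun k k' h =>
  (P.columnHeight_strictMono x).injective (by rw [columnHeight, columnHeight, h])

theorem eq_of_sub_mem_openRect {z : ℝ × ℝ} {g g' : L} {i j : Fin 2}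
    (h : z - g ∈ P.openRect i) (h' : z - g' ∈ P.openRect j) : g = g' ∧ i = j := by
  obtain ⟨k, rfl, rfl⟩ := P.exists_column_eq (Set.Ioo_subset_Ico_self h.1)
  obtain ⟨k', rfl, rfl⟩ := P.exists_column_eq (Set.Ioo_subset_Ico_self h'.1)
  have hz := P.sub_mem_Ioo_bottom_top_iff.1 h.2
  have hz' := P.sub_mem_Ioo_bottom_top_iff.1 h'.2
  have hmono := P.columnHeight_strictMono z.1
  obtain rfl : k = k' := le_antisymm
    (Int.lt_add_one_iff.1 (hmono.lt_iff_lt.1 (hz.1.trans hz'.2)))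
    (Int.lt_add_one_iff.1 (hmono.lt_iff_lt.1 (hz'.1.trans hz.2)))
  exact ⟨rfl, rfl⟩

theorem eq_of_sub_mem_rect {z g : ℝ × ℝ} (hg : g ∈ L) {i j : Fin 2}
    (hz : z ∈ P.openRect i) (h : z - g ∈ P.rect j) : g = 0 ∧ i = j := by
  rw [← closure_openRect] at h
  obtain ⟨w, hwi, hwj⟩ := mem_closure_iff.1 h ((· + g) ⁻¹' P.openRect i)
    ((P.isOpen_openRect i).preimage (continuous_add_const g)) (by simpa using hz)
  obtain ⟨h0, hij⟩ := P.eq_of_sub_mem_openRect (z := w + g) (g := 0) (g' := ⟨g, hg⟩)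
    (by simpa using hwi) (by simpa using hwj)
  exact ⟨congrArg Subtype.val h0.symm, hij⟩

theorem mkQ_notMem_horizontalSpine {i : Fin 2} {z : ℝ × ℝ} (hz : z ∈ P.openRect i) :
    L.mkQ z ∉ P.horizontalSpine := by
  rw [horizontalSpine, mkQ_mem_image_iff]
  rintro ⟨g, hg, hzg⟩
  obtain ⟨j, hj₁, hj₂⟩ := Set.mem_iUnion.1 hzg
  have hj : z - g ∈ P.rect j := ⟨hj₁, by
    rcases hj₂ with h | h <;> rw [h]
    exacts [Set.left_mem_Icc.2 (P.bottom_lt_top j).le, Set.right_mem_Icc.2 (P.bottom_lt_top j).le]⟩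
  obtain ⟨rfl, rfl⟩ := P.eq_of_sub_mem_rect hg hz hj
  rw [sub_zero] at hj₂
  rcases hj₂ with h | h
  exacts [hz.2.1.ne' h, hz.2.2.ne h]

theorem mkQ_notMem_verticalSpine {i : Fin 2} {z : ℝ × ℝ} (hz : z ∈ P.openRect i) :
    L.mkQ z ∉ P.verticalSpine := by
  rw [verticalSpine, mkQ_mem_image_iff]
  rintro ⟨g, hg, hzg⟩
  obtain ⟨j, hj₁, hj₂⟩ := Set.mem_iUnion.1 hzg
  have hj : z - g ∈ P.rect j := ⟨by
    rcases hj₁ with h | h <;> rw [h]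
    exacts [Set.left_mem_Icc.2 (P.left_lt_right j).le, Set.right_mem_Icc.2 (P.left_lt_right j).le],
    hj₂⟩
  obtain ⟨rfl, rfl⟩ := P.eq_of_sub_mem_rect hg hz hj
  rw [sub_zero] at hj₁
  rcases hj₁ with h | h
  exacts [hz.1.1.ne' h, hz.1.2.ne h]

/-- The lattice vectors `g` such that the interior of `R j + g` meets that of the image of `R i`. -/
def crossings (T : HyperbolicToralAut L) (i j : Fin 2) : Set L :=
  {g | ∃ z ∈ P.openRect i, T.lift z - g ∈ P.openRect j}

theorem connectivityMatrix_rect_apply (T : HyperbolicToralAut L) (i j : Fin 2) :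
    T.connectivityMatrix P.rect i j = (P.crossings T i j).ncard := by
  rw [HyperbolicToralAut.connectivityMatrix]
  congr 1
  ext g
  have htranslate : (fun x => (g : ℝ × ℝ) + x) '' P.rect j =
      Homeomorph.addLeft (g : ℝ × ℝ) '' P.rect j := rfl
  rw [Set.mem_ofPred_eq, htranslate, T.interior_image_lift (P.mu_ne_zero T),
    ← Homeomorph.image_interior, interior_rect, interior_rect, Set.image_inter_nonempty_iff]
  refine exists_congr fun z => and_congr_right fun _ => ?_
  rw [Set.mem_preimage, Homeomorph.coe_addLeft, Set.image_add_left, Set.mem_preimage,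
    neg_add_eq_sub]

namespace IsBerg

variable {P : BiPartition L} {T : HyperbolicToralAut L}

theorem mkQ_lift_notMem_verticalSpine (h : P.IsBerg T) {i : Fin 2} {z : ℝ × ℝ}
    (hz : z ∈ P.openRect i) : L.mkQ (T.lift z) ∉ P.verticalSpine := by
  intro hv
  obtain ⟨s, hs, hsz⟩ := h.2 hv
  rw [← T.toralMap_mkQ] at hsz
  exact P.mkQ_notMem_verticalSpine hz (T.toralMap_injective (P.mu_ne_zero T) hsz ▸ hs)

theorem mkQ_lift_mem_horizontalSpine (h : P.IsBerg T) {z : ℝ × ℝ}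
    (hz : L.mkQ z ∈ P.horizontalSpine) : L.mkQ (T.lift z) ∈ P.horizontalSpine :=
  h.1 ⟨_, hz, rfl⟩

theorem mem_Ioo_of_mem_crossings (h : P.IsBerg T) {i j : Fin 2} {g : L}
    (hg : g ∈ P.crossings T i j) {x : ℝ} (hx : x ∈ Set.Ioo (P.left i) (P.right i)) :
    T.mu * x - (g : ℝ × ℝ).1 ∈ Set.Ioo (P.left j) (P.right j) := by
  obtain ⟨z, hz, hzj⟩ := hg
  rw [T.lift_apply] at hzj
  let f : ℝ → ℝ := fun x => T.mu * x - (g : ℝ × ℝ).1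
  have hf : Continuous f := by fun_prop
  have hconn : (f '' Set.Ioo (P.left i) (P.right i)).OrdConnected :=
    (isPreconnected_Ioo.image f hf.continuousOn).ordConnected
  have hside : ∀ t ∈ Set.Ioo (P.left i) (P.right i), f t ≠ P.left j ∧ f t ≠ P.right j := by
    intro t ht
    have hmem : f t = P.left j ∨ f t = P.right j → L.mkQ (T.lift (t, z.2)) ∈ P.verticalSpine :=
      fun hft => mkQ_mem_image_iff.2 ⟨g, g.2, Set.mem_iUnion.2
        ⟨j, by rwa [T.lift_apply], Set.Ioo_subset_Icc_self (by rw [T.lift_apply]; exact hzj.2)⟩⟩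
    exact not_or.1 (mt hmem (h.mkQ_lift_notMem_verticalSpine ⟨ht, hz.2⟩))
  exact subset_Ioo_of_ordConnected hconn ⟨f z.1, Set.mem_image_of_mem f hz.1, hzj.1⟩
    (fun ⟨t, ht, hft⟩ => (hside t ht).1 hft) (fun ⟨t, ht, hft⟩ => (hside t ht).2 hft)
    (Set.mem_image_of_mem f hx)

theorem div_mem_Ioo_of_mem_crossings (h : P.IsBerg T) {i j : Fin 2} {g : L}
    (hg : g ∈ P.crossings T i j) {y : ℝ} (hy : y ∈ Set.Ioo P.bottom (P.top j)) :
    (y + (g : ℝ × ℝ).2) / T.lam ∈ Set.Ioo P.bottom (P.top i) := by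
  obtain ⟨z, hz, hzj⟩ := hg
  rw [T.lift_apply] at hzj
  let f : ℝ → ℝ := fun y => (y + (g : ℝ × ℝ).2) / T.lam
  have hf : Continuous f := by fun_prop
  have hlam : ∀ y, T.lam * f y - (g : ℝ × ℝ).2 = y := fun y => by
    rw [mul_div_cancel₀ _ T.lam_ne_zero, add_sub_cancel_right]
  have hfz : f (T.lam * z.2 - (g : ℝ × ℝ).2) = z.2 := by
    simp only [f, sub_add_cancel, mul_div_cancel_left₀ _ T.lam_ne_zero]
  have hconn : (f '' Set.Ioo P.bottom (P.top j)).OrdConnected :=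
    (isPreconnected_Ioo.image f hf.continuousOn).ordConnected
  have hside : ∀ t ∈ Set.Ioo P.bottom (P.top j), f t ≠ P.bottom ∧ f t ≠ P.top i := by
    intro t ht
    have hopen : T.lift (z.1, f t) - g ∈ P.openRect j := by
      rw [T.lift_apply]
      exact ⟨hzj.1, by simpa only [Prod.snd_sub, hlam] using ht⟩
    have hspine : L.mkQ (z.1, f t) ∉ P.horizontalSpine := fun hs => by
      refine P.mkQ_notMem_horizontalSpine hopen ?_
      rw [map_sub, show L.mkQ (g : ℝ × ℝ) = 0 from (Submodule.Quotient.mk_eq_zero L).2 g.2,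
        sub_zero]
      exact h.mkQ_lift_mem_horizontalSpine hs
    exact not_or.1 fun hft =>
      hspine (Set.mem_image_of_mem _ (Set.mem_iUnion.2 ⟨i, Set.Ioo_subset_Icc_self hz.1, hft⟩))
  exact subset_Ioo_of_ordConnected hconn
    ⟨z.2, ⟨_, hzj.2, hfz⟩, hz.2⟩
    (fun ⟨t, ht, hft⟩ => (hside t ht).1 hft) (fun ⟨t, ht, hft⟩ => (hside t ht).2 hft)
    (Set.mem_image_of_mem f hy)

theorem mem_crossings_iff (h : P.IsBerg T) {i j : Fin 2} {g : L} {x : ℝ}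
    (hx : x ∈ Set.Ioo (P.left i) (P.right i)) :
    g ∈ P.crossings T i j ↔ ∃ k, P.column (T.mu * x) k = g ∧ P.columnRect (T.mu * x) k = j ∧
      ∃ y ∈ Set.Ioo (P.columnHeight (T.mu * x) k) (P.columnHeight (T.mu * x) (k + 1)),
        y / T.lam ∈ Set.Ioo P.bottom (P.top i) := by
  constructor
  · intro hg
    obtain ⟨k, rfl, rfl⟩ :=
      P.exists_column_eq (Set.Ioo_subset_Ico_self (h.mem_Ioo_of_mem_crossings hg hx))
    obtain ⟨z, hz, hzj⟩ := hg
    rw [T.lift_apply] at hzj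
    refine ⟨k, rfl, rfl, T.lam * z.2, P.sub_mem_Ioo_bottom_top_iff.1 hzj.2, ?_⟩
    rw [mul_div_cancel_left₀ _ T.lam_ne_zero]
    exact hz.2
  · rintro ⟨k, rfl, rfl, y, hy, hyi⟩
    have hz : (x, y / T.lam) ∈ P.openRect i := ⟨hx, hyi⟩
    have hlift : T.lift (x, y / T.lam) = (T.mu * x, y) := by
      rw [T.lift_apply, mul_div_cancel₀ _ T.lam_ne_zero]
    have hcol := P.sub_column_mem_Ico (T.mu * x) k
    have hy' := P.sub_mem_Ioo_bottom_top_iff.2 hy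
    have hside : T.mu * x - (P.column (T.mu * x) k : ℝ × ℝ).1 ≠
        P.left (P.columnRect (T.mu * x) k) := fun hleft => by
      refine h.mkQ_lift_notMem_verticalSpine hz (mkQ_mem_image_iff.2
        ⟨_, (P.column (T.mu * x) k).2, Set.mem_iUnion.2 ⟨P.columnRect (T.mu * x) k, ?_⟩⟩)
      rw [hlift]
      exact ⟨Or.inl hleft, Set.Ioo_subset_Icc_self hy'⟩
    refine ⟨_, hz, ?_⟩
    rw [hlift]
    exact ⟨⟨hcol.1.lt_of_ne' hside, hcol.2⟩, hy'⟩

theorem div_mem_Ioo_of_meets (h : P.IsBerg T) {i : Fin 2} {x : ℝ}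
    (hx : x ∈ Set.Ioo (P.left i) (P.right i)) {k : ℤ} {y y' : ℝ}
    (hy : y ∈ Set.Ioo (P.columnHeight (T.mu * x) k) (P.columnHeight (T.mu * x) (k + 1)))
    (hyi : y / T.lam ∈ Set.Ioo P.bottom (P.top i))
    (hy' : y' ∈ Set.Ioo (P.columnHeight (T.mu * x) k) (P.columnHeight (T.mu * x) (k + 1))) :
    y' / T.lam ∈ Set.Ioo P.bottom (P.top i) := by
  have hg := (h.mem_crossings_iff hx).2 ⟨k, rfl, rfl, y, hy, hyi⟩
  simpa only [sub_add_cancel] using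
    h.div_mem_Ioo_of_mem_crossings hg (P.sub_mem_Ioo_bottom_top_iff.2 hy')

theorem abs_lam_mul_generator_snd (h : P.IsBerg T) (i : Fin 2) :
    |T.lam| * (P.generator i).2 =
      ∑ j, T.connectivityMatrix P.rect i j * (P.generator j).2 := by
  obtain ⟨x, hx⟩ := Set.nonempty_Ioo.2 (P.left_lt_right i)
  obtain ⟨c, d, hcd, hlen, hdiv⟩ := exists_div_mem_Ioo_iff T.lam_ne_zero (P.bottom_lt_top i)
  obtain ⟨s, hs, hsum⟩ := exists_finset_sum_sub_eq (P.columnHeight_strictMono (T.mu * x))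
    (P.exists_mem_Ico_columnHeight _) hcd fun k ⟨y, hy, hyi⟩ y' hy' =>
      (hdiv y').1 (h.div_mem_Ioo_of_meets hx hy ((hdiv y).2 hyi) hy')
  have hcrossings : ∀ j, P.crossings T i j = P.column (T.mu * x) ''
      (s.filter fun k => P.columnRect (T.mu * x) k = j : Finset ℤ) := by
    intro j
    ext g
    simp only [h.mem_crossings_iff hx, hdiv, Set.mem_image, Finset.mem_coe, Finset.mem_filter, hs]
    exact exists_congr fun k => by tauto
  calc |T.lam| * (P.generator i).2 = d - c := by rw [hlen, top_eq, add_sub_cancel_left]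
    _ = ∑ k ∈ s, (P.generator (P.columnRect (T.mu * x) k)).2 := by
      simp only [← hsum, columnHeight_add_one, add_sub_cancel_left]
    _ = ∑ j, ∑ k ∈ s with P.columnRect (T.mu * x) k = j, (P.generator j).2 := by
      rw [← Finset.sum_fiberwise s (P.columnRect (T.mu * x))]
      refine Finset.sum_congr rfl fun j _ => Finset.sum_congr rfl fun k hk => ?_
      rw [(Finset.mem_filter.1 hk).2]
    _ = ∑ j, T.connectivityMatrix P.rect i j * (P.generator j).2 := by
      refine Finset.sum_congr rfl fun j _ => ?_
      rw [connectivityMatrix_rect_apply, hcrossings,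
        Set.ncard_image_of_injective _ (P.column_injective _), Set.ncard_coe_finset,
        Finset.sum_const, nsmul_eq_mul]

theorem toMatrix_onLattice [DiscreteTopology L] (h : P.IsBerg T) :
    LinearMap.toMatrix P.basis P.basis T.onLattice =
      (SignType.sign T.lam : ℤ) •
        ((T.connectivityMatrix P.rect).map (Nat.cast : ℕ → ℤ)).transpose := by
  refine (toMatrix_eq_iff _ _ _).2 fun i => T.eq_of_snd_eq ?_
  have hheight : (T.onLattice (P.basis i) : ℝ × ℝ).2 = (SignType.sign T.lam : ℤ) *
      ∑ j, T.connectivityMatrix P.rect i j * (P.generator j).2 := by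
    rw [← h.abs_lam_mul_generator_snd, ← mul_assoc, SignType.intCast_cast, sign_mul_abs,
      ← coe_basis]
    exact congrArg Prod.snd (T.lift_apply _)
  rw [hheight, Fin.sum_univ_two, Fin.sum_univ_two]
  simp only [Matrix.smul_apply, Matrix.transpose_apply, Matrix.map_apply, Submodule.coe_add,
    SetLike.val_smul, coe_basis, Prod.snd_add, Prod.smul_snd, smul_eq_mul]
  simp only [zsmul_eq_mul, Int.cast_mul, Int.cast_natCast]
  ring

end IsBerg

end BiPartition

namespace BiPartition

variable {L : Submodule ℤ (ℝ × ℝ)} (P : BiPartition L)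

theorem generator_mem (i : Fin 2) : P.generator i ∈ L :=
  P.coe_basis i ▸ (P.basis i).2

theorem horizontalSpine_eq : P.horizontalSpine =
    L.mkQ '' Set.Icc (P.base.1 - P.v) (P.base.1 + P.u) ×ˢ {P.base.2} := by
  have hu := P.u_pos
  have hv := P.v_pos
  refine Set.Subset.antisymm (Set.image_subset_iff.2 (Set.iUnion_subset fun i => ?_))
    (Set.image_mono fun z hz => Set.mem_iUnion.2 ?_)
  · rintro z ⟨hz₁, hz₂⟩
    rw [Set.mem_preimage, mkQ_mem_image_iff]
    rcases hz₂ with hbottom | htop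
    · refine ⟨0, L.zero_mem, ?_⟩
      rw [sub_zero]
      refine ⟨Set.Icc_subset_Icc ?_ ?_ hz₁, hbottom⟩
      · fin_cases i
        exacts [sub_le_self _ hv.le, le_rfl]
      · fin_cases i
        exacts [le_rfl, le_add_of_nonneg_right hu.le]
    · refine ⟨P.generator i, P.generator_mem i, ?_, ?_⟩
      · obtain ⟨hl, hr⟩ := hz₁
        fin_cases i <;> simp only [generator, left, right, Matrix.cons_val, Prod.fst_sub,
          Fin.zero_eta, Fin.mk_one] at hl hr ⊢ <;> constructor <;> linarith
      · rw [Set.mem_singleton_iff, Prod.snd_sub, htop, top_eq, add_sub_cancel_right, bottom]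
  · rcases le_total P.base.1 z.1 with h | h
    · exact ⟨0, ⟨h, hz.1.2⟩, Or.inl hz.2⟩
    · exact ⟨1, ⟨hz.1.1, h⟩, Or.inl hz.2⟩

theorem verticalSpine_eq : P.verticalSpine =
    L.mkQ '' {P.base.1} ×ˢ Set.Icc P.base.2 (P.base.2 + (P.p + P.q)) := by
  have hp := P.p_pos
  have hq := P.q_pos
  refine Set.Subset.antisymm (Set.image_subset_iff.2 (Set.iUnion_subset fun i => ?_))
    (Set.image_subset_iff.2 fun z hz => ?_)
  · rintro z ⟨hz₁, hz₂⟩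
    rw [Set.mem_preimage, mkQ_mem_image_iff]
    obtain ⟨g, hg, hgx, hg0, hgq⟩ : ∃ g ∈ L, z.1 - g.1 = P.base.1 ∧ g.2 ≤ 0 ∧
        (P.generator i).2 - g.2 ≤ P.p + P.q := by
      fin_cases i <;> rcases hz₁ with h | h <;> rw [h]
      · exact ⟨0, L.zero_mem, by simp [left], le_rfl, by simp [generator, hq.le]⟩
      · exact ⟨-P.generator 1, L.neg_mem (P.generator_mem 1), by simp [right, generator],
          by simp [generator, hq.le], by simp [generator]⟩
      · exact ⟨-P.generator 0, L.neg_mem (P.generator_mem 0), by simp [left, generator],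
          by simp [generator, hp.le], by simp [generator, add_comm]⟩
      · exact ⟨0, L.zero_mem, by simp [right], le_rfl, by simp [generator, hp.le]⟩
    rw [top_eq, bottom, Set.mem_Icc] at hz₂
    exact ⟨g, hg, hgx, by rw [Prod.snd_sub]; linarith, by rw [Prod.snd_sub]; linarith⟩
  · rw [Set.mem_preimage, verticalSpine, mkQ_mem_image_iff]
    obtain ⟨hz₁ : z.1 = P.base.1, hz₂⟩ := hz
    rcases le_total z.2 (P.base.2 + P.p) with h | h
    · refine ⟨0, L.zero_mem, Set.mem_iUnion.2 ⟨0, ?_⟩⟩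
      rw [sub_zero]
      exact ⟨Or.inl hz₁, hz₂.1, h⟩
    · refine ⟨P.generator 0, P.generator_mem 0, Set.mem_iUnion.2 ⟨1, Or.inl ?_, ?_⟩⟩
      · rw [Prod.fst_sub, hz₁]
        rfl
      · rw [Prod.snd_sub]
        exact ⟨le_sub_iff_add_le.2 h, sub_le_iff_le_add.2 (hz₂.2.trans_eq (by
          rw [top_eq, bottom, add_assoc, add_comm P.p]; rfl))⟩

/- The horizontal spine stays on the stable axis, so it need not be translated; only the vertical
spine has to be moved back by `w`. -/
theorem isBerg_of_mul_base_eq (T : HyperbolicToralAut L) {w : ℝ × ℝ} (hw : w ∈ L)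
    (hbase₁ : T.mu * P.base.1 = P.base.1 + w.1) (hbase₂ : P.base.2 = 0)
    (hx : ∀ x ∈ Set.Icc (-P.v) P.u, w.1 + T.mu * x ∈ Set.Icc (-P.v) P.u)
    (hy : ∀ y ∈ Set.Icc 0 (P.p + P.q), (w.2 + y) / T.lam ∈ Set.Icc 0 (P.p + P.q)) :
    P.IsBerg T := by
  rw [IsBerg, horizontalSpine_eq, verticalSpine_eq, hbase₂, zero_add]
  constructor
  · rintro _ ⟨_, ⟨z, ⟨⟨hz₁, hz₁'⟩, hz₂ : z.2 = 0⟩, rfl⟩, rfl⟩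
    obtain ⟨h₁, h₂⟩ := hx (z.1 - P.base.1) ⟨by linarith, by linarith⟩
    rw [T.toralMap_mkQ, T.lift_apply, hz₂, mul_zero]
    exact Set.mem_image_of_mem _ ⟨⟨by linarith, by linarith⟩, rfl⟩
  · rintro _ ⟨z, ⟨hz₁ : z.1 = P.base.1, hz₂⟩, rfl⟩
    refine ⟨L.mkQ (P.base.1, (w.2 + z.2) / T.lam), Set.mem_image_of_mem _ ⟨rfl, hy z.2 hz₂⟩, ?_⟩
    rw [T.toralMap_mkQ, T.lift_apply, hbase₁, mul_div_cancel₀ _ T.lam_ne_zero]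
    refine (Submodule.Quotient.eq L).2 ?_
    convert hw using 1
    ext <;> simp [hz₁]

/- The index is chosen so that the image of the lower side of `R₁ ∪ R₂` starts, after the
translation, at the left end of that side. -/
theorem exists_fst_add_mu_mul_mem_Icc (T : HyperbolicToralAut L) :
    ∃ i, ∀ x ∈ Set.Icc (-P.v) P.u,
      (T.lift (P.generator i) - P.generator 0).1 + T.mu * x ∈ Set.Icc (-P.v) P.u := by
  obtain ⟨hmu, hmu'⟩ := abs_lt.1 T.abs_mu_lt_one
  rcases le_total 0 T.mu with hmu0 | hmu0
  · refine ⟨0, fun x hx => ?_⟩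
    simp only [T.lift_apply, generator, Matrix.cons_val, Prod.fst_sub]
    constructor <;> nlinarith [hx.1, hx.2]
  · refine ⟨1, fun x hx => ?_⟩
    simp only [T.lift_apply, generator, Matrix.cons_val, Prod.fst_sub]
    constructor <;> nlinarith [hx.1, hx.2]

theorem snd_add_div_lam_mem_Icc (T : HyperbolicToralAut L)
    (h : max P.p P.q ≤ |T.lam| * min P.p P.q) (i : Fin 2) {y : ℝ}
    (hy : y ∈ Set.Icc 0 (P.p + P.q)) :
    ((T.lift (P.generator i) - P.generator 0).2 + y) / T.lam ∈ Set.Icc 0 (P.p + P.q) := by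
  have hshort : |(y - P.p) / T.lam| ≤ min P.p P.q := by
    rw [abs_div, div_le_iff₀ (abs_pos.2 T.lam_ne_zero), mul_comm]
    refine le_trans (abs_le.2 ⟨?_, ?_⟩) h
    · linarith [hy.1, le_max_left P.p P.q]
    · linarith [hy.2, le_max_right P.p P.q]
  obtain ⟨h₁, h₂⟩ := abs_le.1 hshort
  have hsplit : ((T.lift (P.generator i) - P.generator 0).2 + y) / T.lam =
      (P.generator i).2 + (y - P.p) / T.lam := by
    rw [T.lift_apply, Prod.snd_sub, show (P.generator 0).2 = P.p from rfl,
      sub_add, sub_eq_add_neg, neg_sub, add_div, mul_div_cancel_left₀ _ T.lam_ne_zero]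
  have hlow := P.min_le_generator_snd i
  have hhigh := P.generator_snd_le_max i
  rw [hsplit]
  exact ⟨by linarith, by linarith [max_add_min P.p P.q]⟩

theorem exists_base_isBerg (T : HyperbolicToralAut L)
    (h : max P.p P.q ≤ |T.lam| * min P.p P.q) :
    ∃ t, ({P with base := t} : BiPartition L).IsBerg T := by
  obtain ⟨i, hx⟩ := P.exists_fst_add_mu_mul_mem_Icc T
  have hmu : T.mu - 1 ≠ 0 := sub_ne_zero.2 (abs_lt.1 T.abs_mu_lt_one).2.ne
  set w := T.lift (P.generator i) - P.generator 0
  have hw : w ∈ L := L.sub_mem (T.lift_mem _ (P.generator_mem i)) (P.generator_mem 0)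
  refine ⟨(w.1 / (T.mu - 1), 0), isBerg_of_mul_base_eq _ T hw ?_ rfl hx fun y hy =>
    P.snd_add_div_lam_mem_Icc T h i hy⟩
  simp only
  field_simp
  ring

end BiPartition

namespace HyperbolicToralAut

variable {L : Submodule ℤ (ℝ × ℝ)} {T : HyperbolicToralAut L} {b : Module.Basis (Fin 2) ℤ L}
  {C : Matrix (Fin 2) (Fin 2) ℕ} {s : ℤˣ}

open Matrix

theorem mulVec_eq_smul_of_toMatrix_eq
    (hb : LinearMap.toMatrix b b T.onLattice = (s : ℤ) • (C.map (Nat.cast : ℕ → ℤ)).transpose)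
    {ℓ : (ℝ × ℝ) →ₗ[ℝ] ℝ} {r : ℝ} (hℓ : ∀ z, ℓ (T.lift z) = r * ℓ z) :
    C.map (Nat.cast : ℕ → ℝ) *ᵥ (fun i => ℓ (b i)) = ((s : ℤ) * r) • fun i => ℓ (b i) := by
  funext i
  have hi : r * ℓ (b i) = ∑ j, (s : ℤ) * C i j * ℓ (b j) := by
    have h := congrArg (fun x : L => ℓ x) ((toMatrix_eq_iff _ _ _).1 hb i)
    have hlift : ℓ (T.onLattice (b i)) = r * ℓ (b i) := hℓ _
    simpa [hlift, ← Int.cast_smul_eq_zsmul ℝ, -zsmul_eq_mul] using h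
  have hs : ((s : ℤ) : ℝ) * (s : ℤ) = 1 := by
    rw [← Int.cast_mul, ← Units.val_mul, Int.units_mul_self, Units.val_one, Int.cast_one]
  rw [Pi.smul_apply, smul_eq_mul, mul_assoc, hi, Finset.mul_sum, mulVec, dotProduct]
  refine Finset.sum_congr rfl fun j _ => ?_
  rw [map_apply]
  linear_combination -(C i j * ℓ (b j)) * hs

theorem mulVec_fst_eq_smul
    (hb : LinearMap.toMatrix b b T.onLattice = (s : ℤ) • (C.map (Nat.cast : ℕ → ℤ)).transpose) :
    C.map (Nat.cast : ℕ → ℝ) *ᵥ (fun i => (b i : ℝ × ℝ).1) =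
      ((s : ℤ) * T.mu) • fun i => (b i : ℝ × ℝ).1 :=
  mulVec_eq_smul_of_toMatrix_eq (ℓ := LinearMap.fst ℝ ℝ ℝ) hb fun z =>
    congrArg Prod.fst (T.lift_apply z)

theorem mulVec_snd_eq_smul
    (hb : LinearMap.toMatrix b b T.onLattice = (s : ℤ) • (C.map (Nat.cast : ℕ → ℤ)).transpose) :
    C.map (Nat.cast : ℕ → ℝ) *ᵥ (fun i => (b i : ℝ × ℝ).2) =
      ((s : ℤ) * T.lam) • fun i => (b i : ℝ × ℝ).2 :=
  mulVec_eq_smul_of_toMatrix_eq (ℓ := LinearMap.snd ℝ ℝ ℝ) hb fun z =>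
    congrArg Prod.snd (T.lift_apply z)

variable [DiscreteTopology L] [IsZLattice ℝ L]

theorem basis_fst_ne_zero (b : Module.Basis (Fin 2) ℤ L) : (fun i => (b i : ℝ × ℝ).1) ≠ 0 :=
  apply_basis_ne_zero b (ℓ := LinearMap.fst ℝ ℝ ℝ) fun h =>
    one_ne_zero (LinearMap.congr_fun h (1, 0))

theorem basis_snd_ne_zero (b : Module.Basis (Fin 2) ℤ L) : (fun i => (b i : ℝ × ℝ).2) ≠ 0 :=
  apply_basis_ne_zero b (ℓ := LinearMap.snd ℝ ℝ ℝ) fun h =>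
    one_ne_zero (LinearMap.congr_fun h (0, 1))

theorem offDiag_pos_of_toMatrix_eq
    (hb : LinearMap.toMatrix b b T.onLattice = (s : ℤ) • (C.map (Nat.cast : ℕ → ℤ)).transpose) :
    ∀ i j, i ≠ j → 0 < C i j := by
  have hmu : T.mu ≠ 0 := by
    obtain ⟨i, hi⟩ := Function.ne_iff.1 (basis_fst_ne_zero b)
    exact T.mu_ne_zero (b i).2 hi
  have hoff := mul_ne_zero_of_eigenvalue_abs_lt_one (fun i => ⟨C i i, by simp⟩)
    (mul_ne_zero (by exact_mod_cast s.ne_zero) hmu)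
    ((abs_intUnits_mul s _).trans_lt T.abs_mu_lt_one) (basis_fst_ne_zero b) (mulVec_fst_eq_smul hb)
  simp only [map_apply] at hoff
  have h01 : 0 < C 0 1 := Nat.pos_of_ne_zero (by exact_mod_cast left_ne_zero_of_mul hoff)
  have h10 : 0 < C 1 0 := Nat.pos_of_ne_zero (by exact_mod_cast right_ne_zero_of_mul hoff)
  simp [Fin.forall_fin_two, h01, h10]

theorem mul_fst_neg_and_mul_snd_pos
    (hb : LinearMap.toMatrix b b T.onLattice = (s : ℤ) • (C.map (Nat.cast : ℕ → ℤ)).transpose) :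
    (b 0 : ℝ × ℝ).1 * (b 1 : ℝ × ℝ).1 < 0 ∧ 0 < (b 0 : ℝ × ℝ).2 * (b 1 : ℝ × ℝ).2 := by
  have hoff : ∀ i j, i ≠ j → (0 : ℝ) < C i j := fun i j hij =>
    Nat.cast_pos.2 (offDiag_pos_of_toMatrix_eq hb i j hij)
  refine perron_frobenius_fin_two (fun i => Nat.cast_nonneg _) (hoff 0 1 zero_ne_one)
    (hoff 1 0 one_ne_zero) ?_ (basis_fst_ne_zero b) (basis_snd_ne_zero b)
    (mulVec_fst_eq_smul hb) (mulVec_snd_eq_smul hb)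
  rw [abs_intUnits_mul, abs_intUnits_mul]
  exact T.abs_mu_lt_one.trans T.one_lt_abs_lam

theorem exists_basis_pos
    (hb : LinearMap.toMatrix b b T.onLattice = (s : ℤ) • (C.map (Nat.cast : ℕ → ℤ)).transpose) :
    ∃ (b' : Module.Basis (Fin 2) ℤ L) (σ : Equiv.Perm (Fin 2)),
      0 < (b' 0 : ℝ × ℝ).1 ∧ (b' 1 : ℝ × ℝ).1 < 0 ∧ (∀ i, 0 < (b' i : ℝ × ℝ).2) ∧
      LinearMap.toMatrix b' b' T.onLattice =
        (s : ℤ) • ((C.submatrix σ σ).map (Nat.cast : ℕ → ℤ)).transpose := by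
  obtain ⟨hfst, hsnd⟩ := mul_fst_neg_and_mul_snd_pos hb
  obtain ⟨ε, σ, h0, h1, hpos⟩ := exists_sign_perm (x := fun i => (b i : ℝ × ℝ).1)
    (y := fun i => (b i : ℝ × ℝ).2) hfst hsnd
  have hb' : ∀ i, ((b.reindex σ.symm).unitsSMul (fun _ => ε) i : ℝ × ℝ) = ε • (b (σ i) : ℝ × ℝ) :=
    fun i => by rw [Module.Basis.unitsSMul_apply, Module.Basis.reindex_apply]; rfl
  refine ⟨(b.reindex σ.symm).unitsSMul fun _ => ε, σ, ?_, ?_, fun i => ?_, ?_⟩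
  · rw [hb']
    exact h0
  · rw [hb']
    exact h1
  · rw [hb']
    exact hpos (σ i)
  · rw [toMatrix_unitsSMul_reindex, hb]
    rfl

end HyperbolicToralAut

namespace BiPartition

variable {L : Submodule ℤ (ℝ × ℝ)}

theorem exists_basis_eq {b : Module.Basis (Fin 2) ℤ L} (h0 : 0 < (b 0 : ℝ × ℝ).1)
    (h1 : (b 1 : ℝ × ℝ).1 < 0) (hpos : ∀ i, 0 < (b i : ℝ × ℝ).2) :
    ∃ P : BiPartition L, P.basis = b := by
  have hspan : L = Submodule.span ℤ {(b 0 : ℝ × ℝ), (b 1 : ℝ × ℝ)} := by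
    have h := congrArg (Submodule.map L.subtype) b.span_eq
    rw [Submodule.map_span, Submodule.map_subtype_top, ← Set.range_comp] at h
    refine h.symm.trans (congrArg _ (Eq.trans ?_ (Matrix.range_cons_cons_empty _ _ ![])))
    refine congrArg Set.range (funext fun i => ?_)
    fin_cases i <;> rfl
  refine ⟨⟨-(b 1 : ℝ × ℝ).1, (b 0 : ℝ × ℝ).1, (b 0 : ℝ × ℝ).2, (b 1 : ℝ × ℝ).2, 0,
    neg_pos.2 h1, h0, hpos 0, hpos 1, by rwa [neg_neg]⟩,
    Module.Basis.eq_of_apply_eq fun i => Subtype.ext ?_⟩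
  rw [coe_basis]
  fin_cases i
  exacts [rfl, Prod.ext (neg_neg _) rfl]

theorem basis_with_base (P : BiPartition L) (t : ℝ × ℝ) :
    ({P with base := t} : BiPartition L).basis = P.basis :=
  Module.Basis.eq_of_apply_eq fun i => Subtype.ext (by rw [coe_basis, coe_basis]; rfl)

variable {P : BiPartition L} {T : HyperbolicToralAut L} {C : Matrix (Fin 2) (Fin 2) ℕ} {s : ℤˣ}

theorem IsBerg.connectivityMatrix_eq [DiscreteTopology L] (h : P.IsBerg T)
    (hC : LinearMap.toMatrix P.basis P.basis T.onLattice =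
      (s : ℤ) • (C.map (Nat.cast : ℕ → ℤ)).transpose) :
    T.connectivityMatrix P.rect = C := by
  ext i j
  have hij := congrArg (fun A : Matrix _ _ ℤ => (A j i).natAbs)
    (h.toMatrix_onLattice.symm.trans hC)
  have hsign : (SignType.sign T.lam : ℤ).natAbs = 1 := by
    rcases T.lam_ne_zero.lt_or_gt with h | h
    · rw [sign_neg h]; rfl
    · rw [sign_pos h]; rfl
  simpa [Int.natAbs_mul, hsign] using hij

theorem generator_snd_le_abs_lam_mul [DiscreteTopology L] [IsZLattice ℝ L]
    (hC : LinearMap.toMatrix P.basis P.basis T.onLattice =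
      (s : ℤ) • (C.map (Nat.cast : ℕ → ℤ)).transpose)
    (i j : Fin 2) :
    (P.generator j).2 ≤ |T.lam| * (P.generator i).2 := by
  rcases eq_or_ne i j with rfl | hij
  · exact le_mul_of_one_le_left (P.generator_snd_pos i).le T.one_lt_abs_lam.le
  have hoff := T.offDiag_pos_of_toMatrix_eq hC i j hij
  have hrow := congrFun (T.mulVec_snd_eq_smul hC) i
  simp only [coe_basis, Pi.smul_apply, smul_eq_mul] at hrow
  calc (P.generator j).2 ≤ C i j * (P.generator j).2 :=
        le_mul_of_one_le_left (P.generator_snd_pos j).le (by exact_mod_cast hoff)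
    _ ≤ ∑ k, C i k * (P.generator k).2 :=
        Finset.single_le_sum (f := fun k => C i k * (P.generator k).2)
          (fun k _ => mul_nonneg (Nat.cast_nonneg _) (P.generator_snd_pos k).le)
          (Finset.mem_univ j)
    _ = (s : ℤ) * T.lam * (P.generator i).2 := hrow
    _ ≤ |T.lam| * (P.generator i).2 := by
        rw [← abs_intUnits_mul s]
        exact mul_le_mul_of_nonneg_right (le_abs_self _) (P.generator_snd_pos i).le

theorem exists_isBerg_connectivityMatrix_eq [DiscreteTopology L] [IsZLattice ℝ L]
    {b : Module.Basis (Fin 2) ℤ L}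
    (hb : LinearMap.toMatrix b b T.onLattice = (s : ℤ) • (C.map (Nat.cast : ℕ → ℤ)).transpose) :
    ∃ P : BiPartition L, P.IsBerg T ∧
      ∃ σ : Equiv.Perm (Fin 2), T.connectivityMatrix (P.rect ∘ σ) = C := by
  obtain ⟨b', σ, h0, h1, hpos, hb'⟩ := T.exists_basis_pos hb
  obtain ⟨P, rfl⟩ := exists_basis_eq h0 h1 hpos
  have hheight := generator_snd_le_abs_lam_mul hb'
  obtain ⟨t, ht⟩ := P.exists_base_isBerg T (by
    rw [mul_min_of_nonneg _ _ (abs_nonneg _)]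
    exact max_le (le_min (hheight 0 0) (hheight 1 0)) (le_min (hheight 0 1) (hheight 1 1)))
  rw [← P.basis_with_base t] at hb'
  refine ⟨_, ht, σ.symm, ?_⟩
  change (T.connectivityMatrix ({P with base := t} : BiPartition L).rect).submatrix
    σ.symm σ.symm = C
  rw [ht.connectivityMatrix_eq hb']
  ext
  simp

end BiPartition

theorem mainTheorem2 (L : Submodule ℤ (ℝ × ℝ)) [DiscreteTopology L] [IsZLattice ℝ L]
    (T : HyperbolicToralAut L) :
    (∀ P : BiPartition L, P.IsBerg T →
      ∃ b : Module.Basis (Fin 2) ℤ L,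
        (b 0 : ℝ × ℝ) = (P.v, P.p) ∧ (b 1 : ℝ × ℝ) = (-P.u, P.q) ∧
        LinearMap.toMatrix b b T.onLattice =
          (SignType.sign (LinearMap.trace ℝ (ℝ × ℝ) T.lift) : ℤ) •
            ((T.connectivityMatrix P.rect).map (Nat.cast : ℕ → ℤ)).transpose ∧
        (1 < T.lam → LinearMap.toMatrix b b T.onLattice =
          ((T.connectivityMatrix P.rect).map (Nat.cast : ℕ → ℤ)).transpose) ∧
        (T.lam < -1 → LinearMap.toMatrix b b T.onLattice =
          -((T.connectivityMatrix P.rect).map (Nat.cast : ℕ → ℤ)).transpose)) ∧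
    (∀ C : Matrix (Fin 2) (Fin 2) ℕ,
      (∃ b : Module.Basis (Fin 2) ℤ L,
        LinearMap.toMatrix b b T.onLattice = (C.map (Nat.cast : ℕ → ℤ)).transpose ∨
        LinearMap.toMatrix b b T.onLattice = -(C.map (Nat.cast : ℕ → ℤ)).transpose) →
      ∃ P : BiPartition L, P.IsBerg T ∧
        ∃ σ : Equiv.Perm (Fin 2), T.connectivityMatrix (P.rect ∘ σ) = C) := by
  refine ⟨fun P hP => ?_, fun C ⟨b, hb⟩ => ?_⟩
  · have hmat := hP.toMatrix_onLattice
    refine ⟨P.basis, P.coe_basis 0, P.coe_basis 1, ?_, fun h => ?_, fun h => ?_⟩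
    · rw [T.sign_trace_lift, hmat]
    · rw [hmat, sign_pos (by linarith), SignType.coe_one, one_smul]
    · rw [hmat, sign_neg (by linarith), SignType.coe_neg_one, neg_one_smul]
  · rcases hb with hb | hb
    · exact BiPartition.exists_isBerg_connectivityMatrix_eq (s := 1) (by simpa using hb)
    · exact BiPartition.exists_isBerg_connectivityMatrix_eq (s := -1) (by simpa using hb)
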